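/- Let $\mathbb K=\mathbb R$ or $\mathbb C$, let $0<\alpha<2$, let $(S,\mathcal B)$ be a standard Borel space with a $\sigma$-finite measure $\mu$, and let $M$ be a $\mathbb K$-valued independently scattered symmetric $\alpha$-stable ($S\alpha S$) random measure with control measure $\mu$ on a probability space $(\Omega,P)$: for measurable sets of finite $\mu$-measure, $M$ is almost surely $\sigma$-additive, takes independent values on disjoint sets, and $$E\exp\{i\,\mathrm{Re}(\bar z\,M(A))\}=\exp\{-|z|^\alpha\mu(A)\},\qquad z\in\mathbb K .$$ For $f\in L^\alpha(S,\mu)$, $\int_S f\,dM$ denotes the limit in probability of the integrals of simple functions converging to $f$ in $L^\alpha(\mu)$. Assume: (i) $\{\varphi_t\}_{t\in\mathbb R}$ is a flow of measurable maps of $S$ ($\varphi_0=\mathrm{id}$, $\varphi_{t+u}=\varphi_t\circ\varphi_u$) that preserves $\mu$, i.e. $\mu\circ\varphi_t^{-1}=\mu$ for all $t$. (ii) $g_0:S\to\mathbb K$ is a measurable function such that $f_t:=g_0\circ\varphi_t-g_0\in L^\alpha(S,\mu)$ for all $t\in\mathbb R$. (iii) $\{\tilde\varphi_\lambda\}_{\lambda>0}$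 is a multiplicative flow of measurable maps of $S$ ($\tilde\varphi_1=\mathrm{id}$, $\tilde\varphi_{\lambda\kappa}=\tilde\varphi_\lambda\circ\tilde\varphi_\kappa$) that is non-singular, i.e. $\mu(\tilde\varphi_\lambda^{-1}(A))=0$ if and only if $\mu(A)=0$, and for some $r_1\in\mathbb R$ $$\frac{d(\mu\circ\tilde\varphi_\lambda^{-1})}{d\mu}=\lambda^{r_1\alpha}\quad\mu\text{-a.e., for all }\lambda>0 .$$ (iv) For some $r_2\in\mathbb R$, $f_{\lambda t}=\lambda^{r_2}f_t\circ\tilde\varphi_\lambda$ $\mu$-a.e. for all $t>0$, $\lambda>0$. Then the integrals $X_t=\int_S f_t\,dM$, $t\in\mathbb R$, exist, and $\{X_t\}_{t\in\mathbb R}$ is an $S\alpha S$ process (every finite $\mathbb K$-linear combination of the $X_t$ has a, possibly degenerate, $S\alpha S$ distribution, rotationally invariant if $\mathbb K=\mathbb C$). It has stationary increments, i.e. for all $h\in\mathbb R$ $$\{X_{t+h}-X_{s+h},\ t,s\in\mathbb R\}\stackrel d=\{X_t-X_s,\ t,s\in\mathbb R\},$$ and with $H=r_1+r_2$ it is $H$-self-similar,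 i.e. for all $\lambda>0$ $$\{X_{\lambda t},\ t\in\mathbb R\}\stackrel d=\{\lambda^{H}X_t,\ t\in\mathbb R\}.$$ Here $\stackrel d=$ is equality of finite-dimensional distributions. Moreover $H>0$, unless $X_t=0$ almost surely for every $t$. -/

import Mathlib

open MeasureTheory ProbabilityTheory Filter Topology
open scoped ENNReal ComplexConjugate

noncomputable section

/-- The characteristic function `z ↦ E exp (i Re (conj z · Y))` of a `𝕜`-valued random variable `Y`,
where `𝕜` is `ℝ` or `ℂ`. For `𝕜 = ℝ` this is `E exp (i z Y)`. -/
def scalarCharFun {𝕜 Ω : Type*} [RCLike 𝕜] [MeasurableSpace Ω] (P : Measure Ω) (Y : Ω → 𝕜)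
    (z : 𝕜) : ℂ :=
  ∫ ω, Complex.exp (((RCLike.re (conj z * Y ω) : ℝ) : ℂ) * Complex.I) ∂P

/-- `Y` has a symmetric `α`-stable distribution (rotationally invariant if `𝕜 = ℂ`); the
degenerate distribution at `0` (scale `σ = 0`) is included. -/
def IsSaS {𝕜 Ω : Type*} [RCLike 𝕜] [MeasurableSpace Ω] (α : ℝ) (P : Measure Ω)
    (Y : Ω → 𝕜) : Prop :=
  AEMeasurable Y P ∧ ∃ σ : ℝ, 0 ≤ σ ∧
    ∀ z : 𝕜, scalarCharFun P Y z = ((Real.exp (-(σ * ‖z‖) ^ α) : ℝ) : ℂ)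

/-- A process is symmetric `α`-stable if all its finite linear combinations are. -/
def IsSaSProcess {𝕜 Ω T : Type*} [RCLike 𝕜] [MeasurableSpace Ω] (α : ℝ) (P : Measure Ω)
    (X : T → Ω → 𝕜) : Prop :=
  ∀ (I : Finset T) (a : T → 𝕜), IsSaS α P (fun ω => ∑ t ∈ I, a t * X t ω)

/-- `M` is an independently scattered symmetric `α`-stable random measure with control measure `μ`.
Only the values of `M` on measurable sets of finite `μ`-measure matter. Countable additivity is
almost sure convergence of the partial sums (the series need not converge absolutely). -/
structure IsSaSRandomMeasure {𝕜 S Ω : Type*} [RCLike 𝕜] [MeasurableSpace S] [MeasurableSpace Ω]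
    (α : ℝ) (μ : Measure S) (P : Measure Ω) (M : Set S → Ω → 𝕜) : Prop where
  aemeasurable : ∀ A : Set S, MeasurableSet A → μ A < ∞ → AEMeasurable (M A) P
  indep : ∀ A : ℕ → Set S, (∀ n, MeasurableSet (A n)) → (∀ n, μ (A n) < ∞) →
    Pairwise (Function.onFun Disjoint A) → iIndepFun (fun n => M (A n)) P
  additive : ∀ A : ℕ → Set S, (∀ n, MeasurableSet (A n)) → μ (⋃ n, A n) < ∞ →
    Pairwise (Function.onFun Disjoint A) →
    ∀ᵐ ω ∂P, Tendsto (fun N => ∑ n ∈ Finset.range N, M (A n) ω) atTop (𝓝 (M (⋃ n, A n) ω))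
  charFun_eq : ∀ A : Set S, MeasurableSet A → μ A < ∞ →
    ∀ z : 𝕜, scalarCharFun P (M A) z = ((Real.exp (-(‖z‖ ^ α * μ.real A)) : ℝ) : ℂ)

/-- The integral `∑ x · M (φ = x)` of a simple function. -/
def simpleStableIntegral {𝕜 S Ω : Type*} [RCLike 𝕜] [MeasurableSpace S]
    (M : Set S → Ω → 𝕜) (φ : SimpleFunc S 𝕜) : Ω → 𝕜 :=
  fun ω => ∑ x ∈ φ.range, x * M (φ ⁻¹' {x}) ω

/-- The random variable `Y` is (a version of) the stochastic integral `∫ f dM`: it is the limit in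
probability of the integrals of simple functions, vanishing off sets of finite measure, that
converge to `f` in `L^α(μ)`. -/
def IsStableIntegral {𝕜 S Ω : Type*} [RCLike 𝕜] [MeasurableSpace S] [MeasurableSpace Ω]
    (α : ℝ) (μ : Measure S) (P : Measure Ω) (M : Set S → Ω → 𝕜) (f : S → 𝕜) (Y : Ω → 𝕜) : Prop :=
  AEMeasurable Y P ∧ ∃ φ : ℕ → SimpleFunc S 𝕜,
    (∀ n, (φ n).FinMeasSupp μ) ∧
    Tendsto (fun n => eLpNorm (fun s => φ n s - f s) (ENNReal.ofReal α) μ) atTop (𝓝 0) ∧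
    TendstoInMeasure P (fun n => simpleStableIntegral M (φ n)) atTop Y

/-- Equality in distribution of two processes: equality of the finite-dimensional distributions. -/
def EqInLaw {𝕜 Ω T : Type*} [RCLike 𝕜] [MeasurableSpace Ω] (P : Measure Ω)
    (X Y : T → Ω → 𝕜) : Prop :=
  ∀ I : Finset T, IdentDistrib (fun ω (t : I) => X t ω) (fun ω (t : I) => Y t ω) P P

/-- `{X_{t+h} - X_{s+h}, t, s ∈ ℝ}` and `{X_t - X_s, t, s ∈ ℝ}` have the same law for all `h`. -/
def HasStationaryIncrements {𝕜 Ω : Type*} [RCLike 𝕜] [MeasurableSpace Ω] (P : Measure Ω)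
    (X : ℝ → Ω → 𝕜) : Prop :=
  ∀ h : ℝ, EqInLaw P (fun (p : ℝ × ℝ) ω => X (p.1 + h) ω - X (p.2 + h) ω)
    (fun (p : ℝ × ℝ) ω => X p.1 ω - X p.2 ω)

/-- `{X_{l t}, t ∈ ℝ}` and `{l ^ H X_t, t ∈ ℝ}` have the same law for all `l > 0`. The sign of the
exponent `H` is not part of this predicate. -/
def IsSelfSimilar {𝕜 Ω : Type*} [RCLike 𝕜] [MeasurableSpace Ω] (P : Measure Ω) (H : ℝ)
    (X : ℝ → Ω → 𝕜) : Prop :=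
  ∀ l : ℝ, 0 < l → EqInLaw P (fun t ω => X (l * t) ω) (fun t ω => (l ^ H : ℝ) • X t ω)

/-- A flow of measurable maps indexed by the additive group `ℝ`. -/
structure IsFlow {S : Type*} [MeasurableSpace S] (φ : ℝ → S → S) : Prop where
  measurable : ∀ t, Measurable (φ t)
  zero : ∀ s, φ 0 s = s
  add : ∀ t u s, φ (t + u) s = φ t (φ u s)

/-- A flow of measurable maps indexed by the multiplicative group of positive reals; the values at
indices `l ≤ 0` are irrelevant. -/
structure IsMulFlow {S : Type*} [MeasurableSpace S] (ψ : ℝ → S → S) : Prop where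
  measurable : ∀ l, 0 < l → Measurable (ψ l)
  one : ∀ s, ψ 1 s = s
  mul : ∀ l m, 0 < l → 0 < m → ∀ s, ψ (l * m) s = ψ l (ψ m s)

/-- Non-singularity: preimages under `ψ_l`, `l > 0`, of exactly the null sets are null sets. -/
def IsNonsingularMulFlow {S : Type*} [MeasurableSpace S] (μ : Measure S) (ψ : ℝ → S → S) : Prop :=
  IsMulFlow ψ ∧ ∀ l, 0 < l → ∀ A, MeasurableSet A → (μ (ψ l ⁻¹' A) = 0 ↔ μ A = 0)

end

/-!
The argument turns every assertion about laws into an identity between `L^α` quasi-norms.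

Write `‖f‖_α^α = ∫ |f|^α dμ`. Independence on disjoint sets gives the characteristic function
`exp (-|z|^α ‖φ‖_α^α)` for the integral of a simple function `φ`
(`hasSaSLaw_simpleStableIntegral`). The integral is linear up to null sets
(`simpleStableIntegral_linComb`), and a tail estimate through the characteristic function shows
that simple functions that are close in `L^α` have integrals that are close in probability
(`exists_measure_sub_le`). Borel-Cantelli then yields the existence of `∫ f dM`
(`exists_isStableIntegral`), and passing to the limit gives
`E exp (i Re (conj z ∫ f dM)) = exp (-|z|^α ‖f‖_α^α)` (`IsStableIntegral.hasSaSLaw`). As the integral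
is linear in `f`, the law of `(∫ f_t dM)_t` is determined by the numbers `‖∑ a_t f_t‖_α^α`
(`eqInLaw_of_lpModular_eq`).

* Stationary increments: `f_{t+h} - f_{u+h} = (f_t - f_u) ∘ φ_h`, and `φ_h` preserves `μ`.
* Self-similarity: the scaling relation is available for positive times only. A common shift by a
  large `h` reduces arbitrary times to positive ones, because `f_t ∘ φ_h = f_{t+h} - f_h`; then
  `ψ_l` contributes the factor `l^{r₁ α}` and the relation itself `l^{r₂ α}`
  (`lpModular_sum_scaling`).
* Positivity of `H = r₁ + r₂`: suppose `H ≤ 0` and `‖f_T‖_α ≠ 0` for some `T > 0`. For `u ≠ w` in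
  `(0, T)` one has `‖f_u - f_w‖_α = ‖f_{|u-w|}‖_α = (|u-w|/T)^H ‖f_T‖_α ≥ ‖f_T‖_α`, so that
  `(f_u)_{0<u<T}` is an uncountable uniformly separated family. This is impossible because `L^α(μ)`
  is separable (`exists_countable_dense_eLpNorm`). No measurability in `t` is used, and without
  separability the case `H = 0` does occur: differences of an i.i.d. family indexed by `ℝ`.
-/

/-! ### The quasi-norm of `L^α` for arbitrary positive `α` -/

section LpQuasiNorm

variable {S E : Type*} [MeasurableSpace S] [NormedAddCommGroup E] {μ : Measure S} {α : ℝ}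

theorem eLpNorm_rpow_eq_lintegral (hα : 0 < α) (f : S → E) :
    eLpNorm f (ENNReal.ofReal α) μ ^ α = ∫⁻ s, ‖f s‖ₑ ^ α ∂μ := by
  rw [eLpNorm_eq_lintegral_rpow_enorm_toReal (by simpa using hα) (by simp),
    ENNReal.toReal_ofReal hα.le, ← ENNReal.rpow_mul, one_div, inv_mul_cancel₀ hα.ne',
    ENNReal.rpow_one]

/-- For `α ≥ 1` this is Minkowski's inequality, for `α ≤ 1` the subadditivity of `f ↦ ∫ |f|^α`. -/
theorem eLpNorm_rpow_min_add_le (hα : 0 < α) {f g : S → E} (hf : AEStronglyMeasurable f μ)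
    (hg : AEStronglyMeasurable g μ) :
    eLpNorm (f + g) (ENNReal.ofReal α) μ ^ min 1 α ≤
      eLpNorm f (ENNReal.ofReal α) μ ^ min 1 α + eLpNorm g (ENNReal.ofReal α) μ ^ min 1 α := by
  rcases le_total 1 α with h | h
  · simp only [min_eq_left h, ENNReal.rpow_one]
    exact eLpNorm_add_le hf hg (by simpa using h)
  · simp only [min_eq_right h, eLpNorm_rpow_eq_lintegral hα]
    rw [← lintegral_add_left' (hf.enorm.pow_const α)]
    refine lintegral_mono fun s => ?_
    exact (ENNReal.rpow_le_rpow (enorm_add_le _ _) hα.le).trans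
      (ENNReal.rpow_add_le_add_rpow _ _ hα.le h)

theorem tendsto_eLpNorm_of_tendsto_eLpNorm_sub (hα : 0 < α) {φ : ℕ → S → E} {f : S → E}
    (hφ : ∀ n, AEStronglyMeasurable (φ n) μ) (hf : MemLp f (ENNReal.ofReal α) μ)
    (h : Tendsto (fun n => eLpNorm (fun s => φ n s - f s) (ENNReal.ofReal α) μ) atTop (𝓝 0)) :
    Tendsto (fun n => eLpNorm (φ n) (ENNReal.ofReal α) μ) atTop
      (𝓝 (eLpNorm f (ENNReal.ofReal α) μ)) := by
  set p := ENNReal.ofReal α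
  have hm : 0 < min 1 α := lt_min one_pos hα
  have hd : Tendsto (fun n => eLpNorm (φ n - f) p μ ^ min 1 α) atTop (𝓝 0) := by
    have := (ENNReal.continuous_rpow_const (y := min 1 α)).tendsto 0 |>.comp h
    rwa [ENNReal.zero_rpow_of_pos hm] at this
  have hup : ∀ n, eLpNorm (φ n) p μ ^ min 1 α
      ≤ eLpNorm f p μ ^ min 1 α + eLpNorm (φ n - f) p μ ^ min 1 α := fun n => by
    have := eLpNorm_rpow_min_add_le hα hf.1 ((hφ n).sub hf.1)
    rwa [add_sub_cancel] at this
  have hlow : ∀ n, eLpNorm f p μ ^ min 1 α - eLpNorm (φ n - f) p μ ^ min 1 α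
      ≤ eLpNorm (φ n) p μ ^ min 1 α := fun n => by
    have := eLpNorm_rpow_min_add_le hα (hφ n) (hf.1.sub (hφ n))
    rw [add_sub_cancel, eLpNorm_sub_comm f] at this
    exact tsub_le_iff_right.2 this
  have hlim : Tendsto (fun n => eLpNorm (φ n) p μ ^ min 1 α) atTop
      (𝓝 (eLpNorm f p μ ^ min 1 α)) := by
    refine tendsto_of_tendsto_of_tendsto_of_le_of_le ?_ ?_ hlow hup
    · simpa using ENNReal.Tendsto.sub tendsto_const_nhds hd (Or.inr ENNReal.zero_ne_top)
    · simpa using tendsto_const_nhds.add hd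
  have := (ENNReal.continuous_rpow_const (y := (min 1 α)⁻¹)).tendsto _ |>.comp hlim
  simpa [Function.comp_def, ← ENNReal.rpow_mul, mul_inv_cancel₀ hm.ne'] using this

/-- `L^p(μ)` is separable for every finite `p`, including `p < 1`, where `Lp` is not a normed space.
The dense set consists of the finite sums of indicators of sets from a countable measure-dense
family with coefficients from a countable dense set. -/
theorem exists_countable_dense_eLpNorm [MeasurableSpace.CountablyGenerated S] [SigmaFinite μ]
    [TopologicalSpace.SeparableSpace E] (p : ℝ≥0∞) (hp : p ≠ ∞) :
    ∃ D : Set (S → E), D.Countable ∧ (∀ g ∈ D, AEStronglyMeasurable g μ) ∧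
      ∀ f : S → E, MemLp f p μ → ∀ ε : ℝ≥0∞, ε ≠ 0 → ∃ g ∈ D, eLpNorm (f - g) p μ ≤ ε := by
  obtain ⟨𝒜, h𝒜c, h𝒜⟩ := exists_countable_measureDense μ
  have := h𝒜c.to_subtype
  let u : 𝒜 × ℕ → S → E := fun q =>
    (q.1 : Set S).indicator fun _ => TopologicalSpace.denseSeq E q.2
  refine ⟨Set.range fun l : List (𝒜 × ℕ) => (l.map u).sum, Set.countable_range _, ?_, ?_⟩
  · rintro _ ⟨l, rfl⟩
    simp only
    induction l with
    | nil => exact aestronglyMeasurable_const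
    | cons q l ih =>
      rw [List.map_cons, List.sum_cons]
      exact (aestronglyMeasurable_const.indicator (h𝒜.measurable _ q.1.2)).add ih
  intro f hf ε hε
  have key := MemLp.induction_dense (E := E) hp
    (fun g => g ∈ Set.range (fun l : List (𝒜 × ℕ) => (l.map u).sum) ∧ AEStronglyMeasurable g μ)
    ?_ ?_ (fun g hg => hg.2) hf hε
  · obtain ⟨g, hg, hgD, -⟩ := key
    exact ⟨g, hgD, hg⟩
  · intro c s hs hμs δ hδ
    obtain ⟨η, hη, hη'⟩ := exists_Lp_half E μ p hδ
    have : ∃ k, eLpNorm (s.indicator fun _ => TopologicalSpace.denseSeq E k - c) p μ ≤ η := by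
      have hC : μ s ^ (1 / p.toReal) ≠ ∞ := ENNReal.rpow_ne_top_of_nonneg (by positivity) hμs.ne
      have hcont : Continuous fun x : E => ‖x - c‖ₑ * μ s ^ (1 / p.toReal) :=
        (ENNReal.continuous_mul_const hC).comp (by fun_prop)
      obtain ⟨k, hk⟩ := (TopologicalSpace.denseRange_denseSeq E).exists_mem_open
        (isOpen_Iio.preimage hcont) ⟨c, by simpa using hη⟩
      exact ⟨k, (eLpNorm_indicator_const_le _ _).trans (le_of_lt hk)⟩
    obtain ⟨k, hk⟩ := this
    obtain ⟨θ, hθ, hθ'⟩ :=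
      exists_eLpNorm_indicator_le (μ := μ) hp (TopologicalSpace.denseSeq E k) hη.ne'
    obtain ⟨t, ht, hst⟩ := h𝒜.approx s hs hμs.ne θ (by exact_mod_cast hθ)
    have htm := h𝒜.measurable t ht
    have hut : AEStronglyMeasurable (u (⟨t, ht⟩, k)) μ := aestronglyMeasurable_const.indicator htm
    have hs1 : AEStronglyMeasurable (s.indicator fun _ => TopologicalSpace.denseSeq E k) μ :=
      aestronglyMeasurable_const.indicator hs
    have hs2 : AEStronglyMeasurable (s.indicator fun _ => TopologicalSpace.denseSeq E k - c) μ :=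
      aestronglyMeasurable_const.indicator hs
    refine ⟨u (⟨t, ht⟩, k), ?_, ⟨[(⟨t, ht⟩, k)], by simp⟩, hut⟩
    have := hη' _ _ (hut.sub hs1) hs2 ?_ hk
    · rw [show u (⟨t, ht⟩, k) - s.indicator (fun _ => c) =
        u (⟨t, ht⟩, k) - s.indicator (fun _ => TopologicalSpace.denseSeq E k) +
          s.indicator (fun _ => TopologicalSpace.denseSeq E k - c) from ?_]
      · exact this.le
      · funext x
        by_cases hx : x ∈ s <;> simp [hx]
    · rw [eLpNorm_indicator_sub_indicator]
      refine hθ' _ ?_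
      rw [symmDiff_comm]
      simpa using hst.le
  · rintro _ _ ⟨⟨l, rfl⟩, h1⟩ ⟨⟨l', rfl⟩, h2⟩
    exact ⟨⟨l ++ l', by simp⟩, h1.add h2⟩

end LpQuasiNorm

/-! ### Stable laws and characteristic functions -/

section CharFun

variable {𝕜 Ω : Type*} [RCLike 𝕜] [MeasurableSpace Ω] {P : Measure Ω} {α : ℝ}

/-- The real functional `x ↦ Re (conj z * x)` on `𝕜`. -/
noncomputable def reMulCLM (z : 𝕜) : 𝕜 →L[ℝ] ℝ :=
  (RCLike.reCLM : 𝕜 →L[ℝ] ℝ).comp ((ContinuousLinearMap.mul ℝ 𝕜) (conj z))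

@[simp] theorem reMulCLM_apply (z x : 𝕜) : reMulCLM z x = RCLike.re (conj z * x) := rfl

theorem scalarCharFun_eq_charFunDual {Y : Ω → 𝕜} (hY : AEMeasurable Y P) (z : 𝕜) :
    scalarCharFun P Y z = charFunDual (P.map Y) (reMulCLM z) := by
  rw [charFunDual_apply, integral_map hY (by fun_prop)]
  rfl

theorem scalarCharFun_const_mul (c : 𝕜) (Y : Ω → 𝕜) (z : 𝕜) :
    scalarCharFun P (fun ω => c * Y ω) z = scalarCharFun P Y (conj c * z) := by
  simp [scalarCharFun, mul_assoc, mul_left_comm]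

/-- `Y` has characteristic function `exp (-|z|^α v)`. Compared with `IsSaS` the parameter is
`v = σ ^ α`, which for a stable integral is `∫ |f|^α dμ`. -/
def HasSaSLaw (α : ℝ) (P : Measure Ω) (Y : Ω → 𝕜) (v : ℝ) : Prop :=
  AEMeasurable Y P ∧ ∀ z : 𝕜, scalarCharFun P Y z = ((Real.exp (-(‖z‖ ^ α * v)) : ℝ) : ℂ)

theorem HasSaSLaw.isSaS (hα : 0 < α) {Y : Ω → 𝕜} {v : ℝ} (hv : 0 ≤ v) (h : HasSaSLaw α P Y v) :
    IsSaS α P Y := by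
  refine ⟨h.1, v ^ α⁻¹, by positivity, fun z => ?_⟩
  rw [h.2, Real.mul_rpow (by positivity) (by positivity), ← Real.rpow_mul hv,
    inv_mul_cancel₀ hα.ne', Real.rpow_one, mul_comm v]

/-- A tail bound for the component of `Y` in a direction `a`; `a = 1` and `a = I` give the real and
imaginary parts. Only `‖a‖ ≤ 1` is assumed because `I = 0` in the real case. -/
theorem HasSaSLaw.measureReal_re_le [IsProbabilityMeasure P] (hα : 0 < α) {Y : Ω → 𝕜} {v : ℝ}
    (hv : 0 ≤ v) (h : HasSaSLaw α P Y v) {r : ℝ} (hr : 0 < r) {a : 𝕜} (ha : ‖a‖ ≤ 1) :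
    P.real {ω | r < |RCLike.re (conj a * Y ω)|} ≤ 2 * ((2 / r) ^ α * v) := by
  have := Measure.isProbabilityMeasure_map (μ := P) h.1
  have key := measureReal_abs_dual_gt_le_integral_charFunDual (μ := P.map Y) (reMulCLM a) hr
  have hms : MeasurableSet {x : 𝕜 | r < |reMulCLM a x|} :=
    measurableSet_lt measurable_const (by fun_prop)
  rw [map_measureReal_apply_of_aemeasurable h.1 hms] at key
  refine key.trans ?_
  have hb : ∀ t ∈ Set.uIoc (-2 * r⁻¹) (2 * r⁻¹),
      ‖1 - charFunDual (P.map Y) (t • reMulCLM a)‖ ≤ (2 / r) ^ α * v := by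
    intro t ht
    rw [Set.uIoc_of_le (by have := inv_pos.2 hr; linarith)] at ht
    have htr : |t| ≤ 2 / r := by
      rw [abs_le, div_eq_mul_inv]; constructor <;> linarith [ht.1, ht.2]
    have hL : t • reMulCLM a = reMulCLM ((t : 𝕜) * a) := by
      ext x
      simp [mul_assoc]
    rw [hL, ← scalarCharFun_eq_charFunDual h.1, h.2, ← Complex.ofReal_one, ← Complex.ofReal_sub,
      Complex.norm_real, Real.norm_eq_abs]
    have hz : ‖(t : 𝕜) * a‖ ^ α * v ≤ (2 / r) ^ α * v := by
      gcongr
      rw [norm_mul, RCLike.norm_ofReal]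
      calc |t| * ‖a‖ ≤ (2 / r) * 1 := by gcongr
        _ = 2 / r := mul_one _
    have h0 : 0 ≤ ‖(t : 𝕜) * a‖ ^ α * v := by positivity
    rw [abs_of_nonneg (by simpa using h0)]
    linarith [Real.add_one_le_exp (-(‖(t : 𝕜) * a‖ ^ α * v))]
  have := intervalIntegral.norm_integral_le_of_norm_le_const hb
  calc 2⁻¹ * r * ‖∫ t in -2 * r⁻¹..2 * r⁻¹, 1 - charFunDual (P.map Y) (t • reMulCLM a)‖
      ≤ 2⁻¹ * r * ((2 / r) ^ α * v * |2 * r⁻¹ - -2 * r⁻¹|) := by gcongr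
    _ = 2 * ((2 / r) ^ α * v) := by
      rw [show 2 * r⁻¹ - -2 * r⁻¹ = 4 * r⁻¹ by ring, abs_of_pos (by positivity)]
      field_simp
      ring

theorem HasSaSLaw.measureReal_norm_le [IsProbabilityMeasure P] (hα : 0 < α) {Y : Ω → 𝕜} {v : ℝ}
    (hv : 0 ≤ v) (h : HasSaSLaw α P Y v) {r : ℝ} (hr : 0 < r) :
    P.real {ω | 2 * r < ‖Y ω‖} ≤ 4 * ((2 / r) ^ α * v) := by
  have h1 := h.measureReal_re_le hα hv hr (a := 1) (by simp)
  have hI : ‖(RCLike.I : 𝕜)‖ ≤ 1 := by rw [RCLike.norm_I]; split_ifs <;> norm_num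
  have h2 := h.measureReal_re_le hα hv hr hI
  have hsub : {ω | 2 * r < ‖Y ω‖} ⊆ {ω | r < |RCLike.re (conj (1 : 𝕜) * Y ω)|} ∪
      {ω | r < |RCLike.re (conj (RCLike.I : 𝕜) * Y ω)|} := by
    intro ω hω
    by_contra hcon
    simp only [Set.mem_union, Set.mem_ofPred_eq, not_or, not_lt] at hcon hω
    have hre := hcon.1
    have him := hcon.2
    simp only [map_one, one_mul] at hre
    simp only [RCLike.conj_I, neg_mul, map_neg, abs_neg, RCLike.I_mul_re] at him
    have : ‖Y ω‖ ≤ |RCLike.re (Y ω)| + |RCLike.im (Y ω)| * 1 := by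
      calc ‖Y ω‖ = ‖(RCLike.re (Y ω) : 𝕜) + RCLike.im (Y ω) * RCLike.I‖ := by
            rw [RCLike.re_add_im]
        _ ≤ ‖(RCLike.re (Y ω) : 𝕜)‖ + ‖(RCLike.im (Y ω) : 𝕜) * RCLike.I‖ := norm_add_le _ _
        _ ≤ _ := by
          rw [norm_mul, RCLike.norm_ofReal, RCLike.norm_ofReal]
          gcongr
    linarith
  calc _ ≤ _ := measureReal_mono hsub
    _ ≤ _ := measureReal_union_le _ _
    _ ≤ _ := by linarith

theorem HasSaSLaw.ae_eq_zero [IsProbabilityMeasure P] (hα : 0 < α) {Y : Ω → 𝕜}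
    (h : HasSaSLaw α P Y 0) : Y =ᵐ[P] 0 := by
  have : ∀ n : ℕ, ∀ᵐ ω ∂P, ‖Y ω‖ ≤ 2 * (1 / (n + 1 : ℝ)) := fun n => by
    have h1 := h.measureReal_norm_le hα le_rfl (r := 1 / (n + 1 : ℝ)) (by positivity)
    rw [mul_zero, mul_zero, measureReal_def] at h1
    have h2 := (ENNReal.toReal_eq_zero_iff _).1 (le_antisymm h1 ENNReal.toReal_nonneg)
    rw [ae_iff]
    simpa only [not_le] using h2.resolve_right (measure_ne_top _ _)
  filter_upwards [ae_all_iff.2 this] with ω hω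
  have ht : Tendsto (fun n : ℕ => 2 * (1 / (n + 1 : ℝ))) atTop (𝓝 (2 * 0)) :=
    tendsto_one_div_add_atTop_nhds_zero_nat.const_mul 2
  have := ge_of_tendsto' ht hω
  simpa using this

theorem tendsto_scalarCharFun_of_tendsto_ae [IsFiniteMeasure P] {Y : ℕ → Ω → 𝕜} {Z : Ω → 𝕜}
    (hY : ∀ n, AEMeasurable (Y n) P)
    (h : ∀ᵐ ω ∂P, Tendsto (fun n => Y n ω) atTop (𝓝 (Z ω))) (z : 𝕜) :
    Tendsto (fun n => scalarCharFun P (Y n) z) atTop (𝓝 (scalarCharFun P Z z)) := by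
  refine tendsto_integral_of_dominated_convergence (fun _ => 1) (fun n => ?_)
    (integrable_const _) (fun n => ?_) ?_
  · have := hY n
    exact (by fun_prop : AEMeasurable _ P).aestronglyMeasurable
  · exact ae_of_all _ fun ω => (Complex.norm_exp_ofReal_mul_I _).le
  · filter_upwards [h] with ω hω
    have hc : Continuous fun y : 𝕜 =>
      Complex.exp (((RCLike.re (conj z * y) : ℝ) : ℂ) * Complex.I) := by fun_prop
    exact (hc.tendsto _).comp hω

/-- A form of the Cramér-Wold device: random vectors in `𝕜 ^ ι` have the same law as soon as all
their `𝕜`-linear combinations have the same characteristic function at `1`. -/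
theorem identDistrib_of_scalarCharFun_eq [IsFiniteMeasure P] {ι : Type*} [Fintype ι]
    {X Y : ι → Ω → 𝕜} (hX : ∀ i, AEMeasurable (X i) P) (hY : ∀ i, AEMeasurable (Y i) P)
    (h : ∀ a : ι → 𝕜, scalarCharFun P (fun ω => ∑ i, a i * X i ω) 1 =
      scalarCharFun P (fun ω => ∑ i, a i * Y i ω) 1) :
    IdentDistrib (fun ω i => X i ω) (fun ω i => Y i ω) P P := by
  classical
  have hX' : AEMeasurable (fun ω i => X i ω) P := aemeasurable_pi_lambda _ hX
  have hY' : AEMeasurable (fun ω i => Y i ω) P := aemeasurable_pi_lambda _ hY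
  refine ⟨hX', hY', Measure.ext_of_charFunDual ?_⟩
  ext L
  -- Every real functional on `𝕜 ^ ι` is the real part of a `𝕜`-linear one.
  have hL : ∀ x : ι → 𝕜, L x =
      RCLike.re (∑ i, (L.extendRCLike (𝕜 := 𝕜)) (Pi.single i 1) * x i) := by
    intro x
    rw [← StrongDual.re_extendRCLike_apply (𝕜 := 𝕜) L x]
    congr 1
    conv_lhs => rw [pi_eq_sum_univ' x, map_sum]
    refine Finset.sum_congr rfl fun i _ => ?_
    rw [map_smul, smul_eq_mul, mul_comm]
  have := h fun i => (L.extendRCLike (𝕜 := 𝕜)) (Pi.single i 1)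
  rw [charFunDual_apply, charFunDual_apply, integral_map hX' (by fun_prop),
    integral_map hY' (by fun_prop)]
  simpa only [scalarCharFun, map_one, one_mul, ← hL] using this

end CharFun

/-! ### Stable random measures and integrals of simple functions -/

section RandomMeasure

theorem pairwise_disjoint_preimage_singleton {S β : Type*} (ξ : S → β) :
    Pairwise (Function.onFun Disjoint fun b : β => ξ ⁻¹' {b}) := fun _ _ hab =>
  (Set.disjoint_singleton.2 hab).preimage ξ

variable {𝕜 S Ω : Type*} [RCLike 𝕜] [MeasurableSpace S] [MeasurableSpace Ω] {α : ℝ}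
  {μ : Measure S} {P : Measure Ω} {M : Set S → Ω → 𝕜}

/-- The modular `∫ |f|^α dμ` of `L^α(μ)`, as the `α`-th power of the quasi-norm. It has the junk
value `0` if the quasi-norm is infinite. -/
noncomputable def lpModular (α : ℝ) (μ : Measure S) (f : S → 𝕜) : ℝ :=
  (eLpNorm f (ENNReal.ofReal α) μ).toReal ^ α

theorem lpModular_nonneg (f : S → 𝕜) : 0 ≤ lpModular α μ f :=
  Real.rpow_nonneg ENNReal.toReal_nonneg _

theorem lpModular_simpleFunc (hα : 0 < α) (φ : SimpleFunc S 𝕜) (hφ : φ.FinMeasSupp μ) :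
    lpModular α μ φ = ∑ x ∈ φ.range.erase 0, ‖x‖ ^ α * μ.real (φ ⁻¹' {x}) := by
  have h1 : ∫⁻ s, ‖φ s‖ₑ ^ α ∂μ = ∑ x ∈ φ.range, ‖x‖ₑ ^ α * μ (φ ⁻¹' {x}) := by
    rw [← SimpleFunc.map_lintegral (fun x : 𝕜 => ‖x‖ₑ ^ α) φ, ← SimpleFunc.lintegral_eq_lintegral]
    rfl
  have h2 : ∑ x ∈ φ.range, ‖x‖ₑ ^ α * μ (φ ⁻¹' {x}) =
      ∑ x ∈ φ.range.erase 0, ‖x‖ₑ ^ α * μ (φ ⁻¹' {x}) :=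
    (Finset.sum_erase _ (by simp [ENNReal.zero_rpow_of_pos hα])).symm
  rw [lpModular, ENNReal.toReal_rpow, eLpNorm_rpow_eq_lintegral hα, h1, h2, ENNReal.toReal_sum]
  · refine Finset.sum_congr rfl fun x _ => ?_
    rw [ENNReal.toReal_mul, ← ENNReal.toReal_rpow, toReal_enorm, measureReal_def]
  · intro x hx
    exact ENNReal.mul_ne_top (ENNReal.rpow_ne_top_of_nonneg hα.le enorm_ne_top)
      (hφ.meas_preimage_singleton_ne_zero (Finset.ne_of_mem_erase hx)).ne

namespace IsSaSRandomMeasure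

theorem hasSaSLaw (hM : IsSaSRandomMeasure α μ P M) {A : Set S} (hA : MeasurableSet A)
    (hμA : μ A < ∞) : HasSaSLaw α P (M A) (μ.real A) :=
  ⟨hM.aemeasurable A hA hμA, hM.charFun_eq A hA hμA⟩

theorem ae_empty [IsProbabilityMeasure P] (hM : IsSaSRandomMeasure α μ P M) (hα : 0 < α) :
    M ∅ =ᵐ[P] 0 := by
  have := hM.hasSaSLaw MeasurableSet.empty (by simp)
  rw [measureReal_empty] at this
  exact this.ae_eq_zero hα

theorem ae_union [IsProbabilityMeasure P] (hM : IsSaSRandomMeasure α μ P M) (hα : 0 < α)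
    {A B : Set S} (hA : MeasurableSet A) (hB : MeasurableSet B) (hμA : μ A < ∞) (hμB : μ B < ∞)
    (hAB : Disjoint A B) : M (A ∪ B) =ᵐ[P] fun ω => M A ω + M B ω := by
  let C : ℕ → Set S := fun n => if n = 0 then A else if n = 1 then B else ∅
  have hC : ⋃ n, C n = A ∪ B := by
    ext x
    simp only [Set.mem_iUnion, C]
    constructor
    · rintro ⟨n, hn⟩
      split_ifs at hn
      exacts [Or.inl hn, Or.inr hn, hn.elim]
    · rintro (h | h)
      exacts [⟨0, by simpa using h⟩, ⟨1, by simpa using h⟩]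
  have hadd := hM.additive C (fun n => by simp only [C]; split_ifs <;> simp [*])
    (by rw [hC]; exact measure_union_lt_top hμA hμB) (by
      intro m n hmn
      simp only [Function.onFun, C]
      split_ifs <;> simp_all [hAB.symm])
  filter_upwards [hadd, hM.ae_empty hα] with ω hω h0
  rw [hC] at hω
  refine tendsto_nhds_unique hω ?_
  refine tendsto_atTop_of_eventually_const (i₀ := 2) fun N hN => ?_
  rw [← Finset.sum_subset (s₁ := Finset.range 2) (by simpa using hN)]
  · simp [Finset.sum_range_succ, C]
  · intro n _ hn
    simp only [Finset.mem_range, not_lt] at hn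
    have h0n : n ≠ 0 := by omega
    have h1n : n ≠ 1 := by omega
    simpa [C, h0n, h1n] using h0

theorem ae_biUnion [IsProbabilityMeasure P] (hM : IsSaSRandomMeasure α μ P M) (hα : 0 < α)
    {ι : Type*} (s : Finset ι) {A : ι → Set S} (hA : ∀ i ∈ s, MeasurableSet (A i))
    (hμA : ∀ i ∈ s, μ (A i) < ∞) (hdisj : Pairwise (Function.onFun Disjoint A)) :
    M (⋃ i ∈ s, A i) =ᵐ[P] fun ω => ∑ i ∈ s, M (A i) ω := by
  classical
  induction s using Finset.induction with
  | empty =>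
    filter_upwards [hM.ae_empty hα] with ω hω
    simpa using hω
  | insert i s hi ih =>
    have hs := ih (fun j hj => hA j (Finset.mem_insert_of_mem hj))
      (fun j hj => hμA j (Finset.mem_insert_of_mem hj))
    have hu := hM.ae_union hα (hA i (Finset.mem_insert_self i s))
      (Finset.measurableSet_biUnion s fun j hj => hA j (Finset.mem_insert_of_mem hj))
      (hμA i (Finset.mem_insert_self i s))
      (measure_biUnion_lt_top s.finite_toSet fun j hj => hμA j (Finset.mem_insert_of_mem hj))
      (by
        rw [Set.disjoint_iUnion₂_right]
        exact fun j hj => hdisj (by rintro rfl; exact hi hj))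
    rw [Finset.set_biUnion_insert]
    filter_upwards [hs, hu] with ω h1 h2
    rw [h2, h1, Finset.sum_insert hi]

theorem iIndepFun_of_countable (hM : IsSaSRandomMeasure α μ P M) {ι : Type*} [Countable ι]
    {A : ι → Set S} (hA : ∀ i, MeasurableSet (A i)) (hμA : ∀ i, μ (A i) < ∞)
    (hdisj : Pairwise (Function.onFun Disjoint A)) : iIndepFun (fun i => M (A i)) P := by
  obtain ⟨e, he⟩ := exists_injective_nat ι
  let B : ℕ → Set S := Function.extend e A fun _ => ∅
  have hB : ∀ i, B (e i) = A i := fun i => he.extend_apply _ _ i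
  have hB' : ∀ n, (¬ ∃ i, e i = n) → B n = ∅ := fun n hn => Function.extend_apply' _ _ _ hn
  have h := (hM.indep B (fun n => ?_) (fun n => ?_) ?_).precomp he
  · simpa only [hB] using h
  · by_cases hn : ∃ i, e i = n
    · obtain ⟨i, rfl⟩ := hn; rw [hB]; exact hA i
    · rw [hB' n hn]; exact MeasurableSet.empty
  · by_cases hn : ∃ i, e i = n
    · obtain ⟨i, rfl⟩ := hn; rw [hB]; exact hμA i
    · rw [hB' n hn]; simp
  · intro m n hmn
    by_cases hn : ∃ i, e i = n
    · by_cases hm : ∃ i, e i = m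
      · obtain ⟨i, rfl⟩ := hn
        obtain ⟨j, rfl⟩ := hm
        simp only [Function.onFun, hB]
        exact hdisj (by rintro rfl; exact hmn rfl)
      · simp [Function.onFun, hB' m hm]
    · simp [Function.onFun, hB' n hn]

end IsSaSRandomMeasure

/-- The value `0` has to be left out before independence or additivity of `M` can be used, since
`φ ⁻¹' {0}` may have infinite measure. -/
theorem simpleStableIntegral_eq_sum_erase {Ω : Type*} {M : Set S → Ω → 𝕜} (φ : SimpleFunc S 𝕜) :
    simpleStableIntegral M φ = fun ω => ∑ x ∈ φ.range.erase 0, x * M (φ ⁻¹' {x}) ω := by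
  funext ω
  exact (Finset.sum_erase _ (by simp)).symm

theorem hasSaSLaw_simpleStableIntegral [IsProbabilityMeasure P] (hα : 0 < α)
    (hM : IsSaSRandomMeasure α μ P M)
    (φ : SimpleFunc S 𝕜) (hφ : φ.FinMeasSupp μ) :
    HasSaSLaw α P (simpleStableIntegral M φ) (lpModular α μ φ) := by
  have hfin : ∀ x ∈ φ.range.erase 0, μ (φ ⁻¹' {x}) < ∞ := fun x hx =>
    hφ.meas_preimage_singleton_ne_zero (Finset.ne_of_mem_erase hx)
  have hmeas : ∀ x ∈ φ.range.erase 0, AEMeasurable (fun ω => x * M (φ ⁻¹' {x}) ω) P :=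
    fun x hx => (hM.aemeasurable _ (φ.measurableSet_fiber x) (hfin x hx)).const_mul x
  have hind : iIndepFun ((φ.range.erase 0).restrict fun x ω => x * M (φ ⁻¹' {x}) ω) P := by
    have := hM.iIndepFun_of_countable (A := fun x : (φ.range.erase 0 : Finset 𝕜) => φ ⁻¹' {x.1})
      (fun x => φ.measurableSet_fiber _) (fun x => hfin _ x.2)
      (fun x y hxy => pairwise_disjoint_preimage_singleton φ fun h => hxy (Subtype.ext h))
    exact this.comp (fun x y => x.1 * y) fun x => measurable_const_mul _
  have hae : AEMeasurable (simpleStableIntegral M φ) P := by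
    rw [simpleStableIntegral_eq_sum_erase]
    exact Finset.aemeasurable_fun_sum _ hmeas
  refine ⟨hae, fun z => ?_⟩
  rw [scalarCharFun_eq_charFunDual hae, simpleStableIntegral_eq_sum_erase,
    hind.charFunDual_map_fun_finsetSum_eq_prod hmeas, Finset.prod_apply]
  have : ∀ x ∈ φ.range.erase 0, charFunDual (P.map fun ω => x * M (φ ⁻¹' {x}) ω) (reMulCLM z) =
      ((Real.exp (-(‖z‖ ^ α * (‖x‖ ^ α * μ.real (φ ⁻¹' {x})))) : ℝ) : ℂ) := fun x hx => by
    rw [← scalarCharFun_eq_charFunDual (hmeas x hx), scalarCharFun_const_mul,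
      hM.charFun_eq _ (φ.measurableSet_fiber x) (hfin x hx), norm_mul, RCLike.norm_conj,
      Real.mul_rpow (norm_nonneg _) (norm_nonneg _), mul_left_comm, mul_assoc]
  rw [Finset.prod_congr rfl this, ← Complex.ofReal_prod, ← Real.exp_sum,
    lpModular_simpleFunc hα φ hφ, Finset.mul_sum, Finset.sum_neg_distrib]

/-- The integral of `h ∘ ξ` may be computed on the level sets of `ξ`, which form a finer partition
than those of `h ∘ ξ`. -/
theorem simpleStableIntegral_map [IsProbabilityMeasure P] (hα : 0 < α)
    (hM : IsSaSRandomMeasure α μ P M) {β : Type*} [Zero β] (ξ : SimpleFunc S β)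
    (hξ : ξ.FinMeasSupp μ) (h : β → 𝕜) (h0 : h 0 = 0) :
    simpleStableIntegral M (ξ.map h) =ᵐ[P] fun ω => ∑ b ∈ ξ.range, h b * M (ξ ⁻¹' {b}) ω := by
  classical
  have hfib : ∀ x ∈ (ξ.map h).range, ∀ᵐ ω ∂P, x * M (ξ.map h ⁻¹' {x}) ω =
      ∑ b ∈ ξ.range with h b = x, h b * M (ξ ⁻¹' {b}) ω := by
    intro x _
    rcases eq_or_ne x 0 with rfl | hx
    · refine ae_of_all _ fun ω => ?_
      rw [zero_mul, Finset.sum_eq_zero]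
      intro b hb
      rw [(Finset.mem_filter.1 hb).2, zero_mul]
    · have hb0 : ∀ b ∈ ξ.range.filter (h · = x), b ≠ 0 := by
        rintro b hb rfl
        exact hx ((Finset.mem_filter.1 hb).2.symm.trans h0)
      have := hM.ae_biUnion hα (ξ.range.filter (h · = x)) (A := fun b => ξ ⁻¹' {b})
        (fun b _ => ξ.measurableSet_fiber b)
        (fun b hb => hξ.meas_preimage_singleton_ne_zero (hb0 b hb))
        (pairwise_disjoint_preimage_singleton ξ)
      have hset : (ξ.map h) ⁻¹' {x} = ⋃ b ∈ ξ.range.filter (h · = x), ξ ⁻¹' {b} := by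
        rw [SimpleFunc.map_preimage_singleton]
        ext s
        simp
      filter_upwards [this] with ω hω
      rw [hset, hω, Finset.mul_sum]
      refine Finset.sum_congr rfl fun b hb => ?_
      rw [(Finset.mem_filter.1 hb).2]
  filter_upwards [(ae_ball_iff (ξ.map h).range.countable_toSet).2 hfib] with ω hω
  rw [simpleStableIntegral, Finset.sum_congr rfl hω]
  refine Finset.sum_fiberwise_of_maps_to (fun b hb => ?_) _
  obtain ⟨s, rfl⟩ := SimpleFunc.mem_range.1 hb
  exact SimpleFunc.mem_range.2 ⟨s, rfl⟩

/-- The simple function `a φ + b ψ`, presented as a function of the pair `(φ, ψ)`. -/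
noncomputable def MeasureTheory.SimpleFunc.linComb (a b : 𝕜) (φ ψ : SimpleFunc S 𝕜) :
    SimpleFunc S 𝕜 :=
  (φ.pair ψ).map fun p => a * p.1 + b * p.2

@[simp] theorem MeasureTheory.SimpleFunc.linComb_apply (a b : 𝕜) (φ ψ : SimpleFunc S 𝕜) (s : S) :
    SimpleFunc.linComb a b φ ψ s = a * φ s + b * ψ s := rfl

theorem MeasureTheory.SimpleFunc.linComb_finMeasSupp (a b : 𝕜) {φ ψ : SimpleFunc S 𝕜}
    (hφ : φ.FinMeasSupp μ) (hψ : ψ.FinMeasSupp μ) : (SimpleFunc.linComb a b φ ψ).FinMeasSupp μ :=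
  (hφ.pair hψ).map (by simp)

theorem simpleStableIntegral_linComb [IsProbabilityMeasure P] (hα : 0 < α)
    (hM : IsSaSRandomMeasure α μ P M) (a b : 𝕜) {φ ψ : SimpleFunc S 𝕜} (hφ : φ.FinMeasSupp μ)
    (hψ : ψ.FinMeasSupp μ) :
    simpleStableIntegral M (SimpleFunc.linComb a b φ ψ) =ᵐ[P]
      fun ω => a * simpleStableIntegral M φ ω + b * simpleStableIntegral M ψ ω := by
  have h := simpleStableIntegral_map hα hM (φ.pair ψ) (hφ.pair hψ)
  filter_upwards [h (fun p => a * p.1 + b * p.2) (by simp), h Prod.fst rfl, h Prod.snd rfl]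
    with ω h1 h2 h3
  rw [SimpleFunc.map_fst_pair] at h2
  rw [SimpleFunc.map_snd_pair] at h3
  rw [SimpleFunc.linComb, h1, h2, h3, Finset.mul_sum, Finset.mul_sum, ← Finset.sum_add_distrib]
  exact Finset.sum_congr rfl fun p _ => by ring

end RandomMeasure

/-! ### The stable integral -/

section StableIntegral

variable {𝕜 S Ω : Type*} [RCLike 𝕜] [MeasurableSpace S] [MeasurableSpace Ω] {α : ℝ}
  {μ : Measure S} {P : Measure Ω} {M : Set S → Ω → 𝕜}

theorem MeasureTheory.TendstoInMeasure.const_mul {a : 𝕜} {X : ℕ → Ω → 𝕜} {Y : Ω → 𝕜}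
    (h : TendstoInMeasure P X atTop Y) :
    TendstoInMeasure P (fun n ω => a * X n ω) atTop fun ω => a * Y ω := by
  rw [tendstoInMeasure_iff_norm] at h ⊢
  intro ε hε
  refine tendsto_of_tendsto_of_tendsto_of_le_of_le tendsto_const_nhds
    (h (ε / (‖a‖ + 1)) (by positivity)) (fun n => zero_le) fun n => measure_mono fun ω hω => ?_
  simp only [Set.mem_ofPred_eq, ← mul_sub, norm_mul] at hω ⊢
  rw [div_le_iff₀ (by positivity)]
  nlinarith [norm_nonneg (X n ω - Y ω)]

theorem MeasureTheory.TendstoInMeasure.add {X X' : ℕ → Ω → 𝕜} {Y Y' : Ω → 𝕜}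
    (h : TendstoInMeasure P X atTop Y) (h' : TendstoInMeasure P X' atTop Y') :
    TendstoInMeasure P (fun n ω => X n ω + X' n ω) atTop fun ω => Y ω + Y' ω := by
  rw [tendstoInMeasure_iff_norm] at h h' ⊢
  intro ε hε
  have hsum := (h (ε / 2) (by positivity)).add (h' (ε / 2) (by positivity))
  rw [add_zero] at hsum
  refine tendsto_of_tendsto_of_tendsto_of_le_of_le tendsto_const_nhds hsum (fun n => zero_le)
    fun n => (measure_mono fun ω hω => ?_).trans (measure_union_le _ _)
  by_contra hcon
  simp only [Set.mem_union, Set.mem_ofPred_eq, not_or, not_le] at hcon hω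
  have := norm_add_le (X n ω - Y ω) (X' n ω - Y' ω)
  rw [sub_add_sub_comm] at this
  linarith [hcon.1, hcon.2]

theorem tendsto_eLpNorm_add_zero {p : ℝ≥0∞} {u v : ℕ → S → 𝕜}
    (hu : ∀ n, AEStronglyMeasurable (u n) μ) (hv : ∀ n, AEStronglyMeasurable (v n) μ)
    (hu0 : Tendsto (fun n => eLpNorm (u n) p μ) atTop (𝓝 0))
    (hv0 : Tendsto (fun n => eLpNorm (v n) p μ) atTop (𝓝 0)) :
    Tendsto (fun n => eLpNorm (u n + v n) p μ) atTop (𝓝 0) := by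
  refine tendsto_of_tendsto_of_tendsto_of_le_of_le tendsto_const_nhds ?_ (fun n => zero_le)
    fun n => eLpNorm_add_le' (hu n) (hv n) p
  have := ENNReal.Tendsto.const_mul (hu0.add hv0) (Or.inr (ENNReal.LpAddConst_lt_top p).ne)
  simpa using this

namespace IsStableIntegral

theorem linComb [IsProbabilityMeasure P] (hα : 0 < α) (hM : IsSaSRandomMeasure α μ P M) (a b : 𝕜)
    {f g : S → 𝕜} {Y Z : Ω → 𝕜} (hf : AEStronglyMeasurable f μ) (hg : AEStronglyMeasurable g μ)
    (hY : IsStableIntegral α μ P M f Y) (hZ : IsStableIntegral α μ P M g Z) :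
    IsStableIntegral α μ P M (fun s => a * f s + b * g s) (fun ω => a * Y ω + b * Z ω) := by
  obtain ⟨hYm, φ, hφ, hφf, hφY⟩ := hY
  obtain ⟨hZm, ψ, hψ, hψg, hψZ⟩ := hZ
  refine ⟨(hYm.const_mul a).add (hZm.const_mul b), fun n => SimpleFunc.linComb a b (φ n) (ψ n),
    fun n => SimpleFunc.linComb_finMeasSupp a b (hφ n) (hψ n), ?_, ?_⟩
  · have hsmul : ∀ (c : 𝕜) {u : ℕ → S → 𝕜},
        Tendsto (fun n => eLpNorm (u n) (ENNReal.ofReal α) μ) atTop (𝓝 0) →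
        Tendsto (fun n => eLpNorm (c • u n) (ENNReal.ofReal α) μ) atTop (𝓝 0) := by
      intro c u hu
      simp only [eLpNorm_const_smul]
      simpa using ENNReal.Tendsto.const_mul (a := ‖c‖ₑ) hu (Or.inr enorm_ne_top)
    have hφm : ∀ n, AEStronglyMeasurable (fun s => φ n s - f s) μ :=
      fun n => (φ n).aestronglyMeasurable.sub hf
    have hψm : ∀ n, AEStronglyMeasurable (fun s => ψ n s - g s) μ :=
      fun n => (ψ n).aestronglyMeasurable.sub hg
    convert! tendsto_eLpNorm_add_zero (fun n => (hφm n).const_smul a)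
      (fun n => (hψm n).const_smul b) (hsmul a hφf) (hsmul b hψg) using 3 with n
    funext s
    simp only [SimpleFunc.linComb_apply, Pi.add_apply, Pi.smul_apply, smul_eq_mul]
    ring
  · refine TendstoInMeasure.congr_left (fun n => ?_)
      (MeasureTheory.TendstoInMeasure.add (MeasureTheory.TendstoInMeasure.const_mul (a := a) hφY)
        (MeasureTheory.TendstoInMeasure.const_mul (a := b) hψZ))
    exact (simpleStableIntegral_linComb hα hM a b (hφ n) (hψ n)).symm

theorem finsetSum [IsProbabilityMeasure P] (hα : 0 < α) (hM : IsSaSRandomMeasure α μ P M)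
    {ι : Type*} (I : Finset ι) (a : ι → 𝕜)
    {f : ι → S → 𝕜} {Y : ι → Ω → 𝕜} (hf : ∀ i ∈ I, AEStronglyMeasurable (f i) μ)
    (hY : ∀ i ∈ I, IsStableIntegral α μ P M (f i) (Y i)) :
    IsStableIntegral α μ P M (fun s => ∑ i ∈ I, a i * f i s) (fun ω => ∑ i ∈ I, a i * Y i ω) := by
  classical
  induction I using Finset.induction with
  | empty =>
    refine ⟨by simp, fun _ => 0, fun _ => by simp [SimpleFunc.finMeasSupp_iff_support], ?_, ?_⟩
    · simp
    · have h0 : ∀ ω, simpleStableIntegral M (0 : SimpleFunc S 𝕜) ω = 0 := fun ω =>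
        Finset.sum_eq_zero fun x hx => by
          obtain ⟨s, rfl⟩ := SimpleFunc.mem_range.1 hx
          simp
      rw [tendstoInMeasure_iff_norm]
      intro ε hε
      simp [h0, not_le.2 hε]
  | insert i I hi ih =>
    have h1 := ih (fun j hj => hf j (Finset.mem_insert_of_mem hj))
      fun j hj => hY j (Finset.mem_insert_of_mem hj)
    have h2 := linComb hα hM (a i) 1 (hf i (Finset.mem_insert_self i I))
      (Finset.aestronglyMeasurable_fun_sum I fun j hj =>
        (hf j (Finset.mem_insert_of_mem hj)).const_mul (a j))
      (hY i (Finset.mem_insert_self i I)) h1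
    simpa only [Finset.sum_insert hi, one_mul] using h2

theorem hasSaSLaw [IsProbabilityMeasure P] (hα : 0 < α) (hM : IsSaSRandomMeasure α μ P M)
    {f : S → 𝕜} {Y : Ω → 𝕜} (hf : MemLp f (ENNReal.ofReal α) μ)
    (hY : IsStableIntegral α μ P M f Y) : HasSaSLaw α P Y (lpModular α μ f) := by
  obtain ⟨hYm, φ, hφ, hφf, hφY⟩ := hY
  refine ⟨hYm, fun z => ?_⟩
  have hlaw := fun n => hasSaSLaw_simpleStableIntegral hα hM (φ n) (hφ n)
  obtain ⟨ns, hns, hae⟩ := hφY.exists_seq_tendsto_ae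
  have h1 := tendsto_scalarCharFun_of_tendsto_ae (fun n => (hlaw (ns n)).1) hae z
  refine tendsto_nhds_unique h1 ?_
  simp only [fun n => (hlaw n).2 z]
  have h2 := tendsto_eLpNorm_of_tendsto_eLpNorm_sub hα
    (fun n => (φ n).aestronglyMeasurable) hf hφf
  have h3 : Tendsto (fun n => lpModular α μ (φ n)) atTop (𝓝 (lpModular α μ f)) :=
    ((ENNReal.tendsto_toReal hf.2.ne).comp h2).rpow_const (Or.inr hα.le)
  have h4 : Continuous fun v : ℝ => ((Real.exp (-(‖z‖ ^ α * v)) : ℝ) : ℂ) := by fun_prop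
  exact (h4.tendsto _).comp (h3.comp hns.tendsto_atTop)

end IsStableIntegral

/-- Continuity of the integral in probability on simple functions near `f`. -/
theorem exists_measure_sub_le [IsProbabilityMeasure P] (hα : 0 < α)
    (hM : IsSaSRandomMeasure α μ P M) {f : S → 𝕜} (hf : AEStronglyMeasurable f μ)
    {r : ℝ} (hr : 0 < r) :
    ∃ η : ℝ≥0∞, 0 < η ∧ ∀ φ ψ : SimpleFunc S 𝕜, φ.FinMeasSupp μ → ψ.FinMeasSupp μ →
      eLpNorm (f - ⇑φ) (ENNReal.ofReal α) μ ≤ η → eLpNorm (f - ⇑ψ) (ENNReal.ofReal α) μ ≤ η →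
      P {ω | 2 * r < ‖simpleStableIntegral M φ ω - simpleStableIntegral M ψ ω‖} ≤
        ENNReal.ofReal r := by
  set δ : ℝ := (r / (4 * (2 / r) ^ α)) ^ α⁻¹
  have hδ : 0 < δ := by positivity
  have hδα : 4 * ((2 / r) ^ α * δ ^ α) = r := by
    rw [← Real.rpow_mul (by positivity), inv_mul_cancel₀ hα.ne', Real.rpow_one]
    field_simp
  obtain ⟨η, hη, h⟩ := exists_Lp_half 𝕜 μ (ENNReal.ofReal α) (ENNReal.ofReal_pos.2 hδ).ne'
  refine ⟨η, hη, fun φ ψ hφ hψ h1 h2 => ?_⟩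
  have hsupp := SimpleFunc.linComb_finMeasSupp 1 (-1) hφ hψ
  have hnorm : eLpNorm (SimpleFunc.linComb 1 (-1) φ ψ) (ENNReal.ofReal α) μ < ENNReal.ofReal δ := by
    rw [eLpNorm_sub_comm] at h1
    have := h _ _ (φ.aestronglyMeasurable.sub hf) (hf.sub ψ.aestronglyMeasurable) h1 h2
    convert! this using 2
    funext s
    simp [sub_eq_add_neg]
  have hmod : lpModular α μ (SimpleFunc.linComb 1 (-1) φ ψ) ≤ δ ^ α :=
    Real.rpow_le_rpow ENNReal.toReal_nonneg
      (ENNReal.toReal_le_of_le_ofReal hδ.le hnorm.le) hα.le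
  have htail := (hasSaSLaw_simpleStableIntegral hα hM _ hsupp).measureReal_norm_le hα
    (lpModular_nonneg _) hr
  have hle : P.real {ω | 2 * r < ‖simpleStableIntegral M (SimpleFunc.linComb 1 (-1) φ ψ) ω‖} ≤ r :=

    htail.trans (le_of_le_of_eq (by gcongr) hδα)
  rw [measureReal_def, ← ENNReal.le_ofReal_iff_toReal_le (measure_ne_top _ _) hr.le] at hle
  refine le_trans (le_of_eq (measure_congr ?_)) hle
  filter_upwards [simpleStableIntegral_linComb hα hM 1 (-1) hφ hψ] with ω hω
  refine propext ?_
  change 2 * r < _ ↔ 2 * r < _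
  rw [hω, one_mul, neg_one_mul, ← sub_eq_add_neg]

theorem exists_isStableIntegral [IsProbabilityMeasure P] (hα : 0 < α)
    (hM : IsSaSRandomMeasure α μ P M) {f : S → 𝕜} (hf : MemLp f (ENNReal.ofReal α) μ) :
    ∃ Y : Ω → 𝕜, IsStableIntegral α μ P M f Y := by
  have hp0 : ENNReal.ofReal α ≠ 0 := by simpa using hα
  have hr : ∀ n : ℕ, (0 : ℝ) < (1 / 2) ^ n := fun n => by positivity
  choose η hη hη' using fun n : ℕ => exists_measure_sub_le hα hM hf.1 (hr n)
  -- The bound `η (n - 1)` makes both `φ n` and `φ (n + 1)` admissible in the estimate with `η n`.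
  have hδ : ∀ n : ℕ, min (min (η n) (η (n - 1))) (n + 1 : ℝ≥0∞)⁻¹ ≠ 0 := fun n => by
    refine (lt_min (lt_min (hη _) (hη _)) ?_).ne'
    simp
  choose φ hφ hφL using fun n => hf.exists_simpleFunc_eLpNorm_sub_lt (by simp) (hδ n)
  have hφs : ∀ n, (φ n).FinMeasSupp μ := fun n =>
    (SimpleFunc.memLp_iff_finMeasSupp hp0 (by simp)).1 (hφL n)
  set J := fun n => simpleStableIntegral M (φ n)
  have hJm : ∀ n, AEMeasurable (J n) P := fun n =>
    (hasSaSLaw_simpleStableIntegral hα hM _ (hφs n)).1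
  have hstep : ∀ n, P {ω | 2 * (1 / 2 : ℝ) ^ n < ‖J n ω - J (n + 1) ω‖} ≤
      ENNReal.ofReal ((1 / 2) ^ n) := fun n =>
    hη' n _ _ (hφs n) (hφs (n + 1))
      ((hφ n).le.trans ((min_le_left _ _).trans (min_le_left _ _)))
      ((hφ (n + 1)).le.trans ((min_le_left _ _).trans (min_le_right _ _)))
  have hsum : ∑' n, P {ω | 2 * (1 / 2 : ℝ) ^ n < ‖J n ω - J (n + 1) ω‖} ≠ ∞ :=
    ne_top_of_le_ne_top
      (summable_geometric_of_lt_one (by norm_num) (by norm_num : (1 / 2 : ℝ) < 1)).tsum_ofReal_ne_top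
      (ENNReal.tsum_le_tsum hstep)
  have hlim : ∀ᵐ ω ∂P, ∃ y, Tendsto (fun n => J n ω) atTop (𝓝 y) := by
    filter_upwards [ae_eventually_notMem hsum] with ω hω
    refine cauchySeq_tendsto_of_complete (cauchySeq_of_summable_dist ?_)
    refine Summable.of_norm_bounded_eventually_nat
      ((summable_geometric_of_lt_one (by norm_num) (by norm_num : (1 / 2 : ℝ) < 1)).mul_left 2) ?_
    filter_upwards [hω] with n hn
    rw [Real.norm_of_nonneg dist_nonneg, dist_eq_norm]
    exact not_lt.1 hn
  obtain ⟨Y, hYm, hY⟩ := measurable_limit_of_tendsto_metrizable_ae hJm hlim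
  refine ⟨Y, hYm.aemeasurable, φ, hφs, ?_, ?_⟩
  · refine tendsto_of_tendsto_of_tendsto_of_le_of_le tendsto_const_nhds
      (ENNReal.tendsto_inv_nat_nhds_zero.comp (tendsto_add_atTop_nat 1)) (fun n => zero_le)
      fun n => ?_
    have := (hφ n).le.trans (min_le_right _ _)
    rw [eLpNorm_sub_comm] at this
    rw [Function.comp_apply, Nat.cast_add, Nat.cast_one]
    exact this
  · exact tendstoInMeasure_of_tendsto_ae (fun n => (hJm n).aestronglyMeasurable) hY

end StableIntegral

/-! ### Laws of families of stable integrals -/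

section StableFamily

variable {𝕜 S Ω : Type*} [RCLike 𝕜] [MeasurableSpace S] [MeasurableSpace Ω] {α : ℝ}
  {μ : Measure S} {P : Measure Ω} {M : Set S → Ω → 𝕜}

theorem lpModular_const_mul (c : 𝕜) (f : S → 𝕜) :
    lpModular α μ (fun s => c * f s) = ‖c‖ ^ α * lpModular α μ f := by
  have : (fun s => c * f s) = c • f := rfl
  rw [this, lpModular, eLpNorm_const_smul, ENNReal.toReal_mul, toReal_enorm,
    Real.mul_rpow (norm_nonneg _) ENNReal.toReal_nonneg, lpModular]

theorem lpModular_comp_measurePreserving {f : S → 𝕜} (hf : AEStronglyMeasurable f μ) {T : S → S}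
    (hT : MeasurePreserving T μ μ) : lpModular α μ (fun s => f (T s)) = lpModular α μ f := by
  have : (fun s => f (T s)) = f ∘ T := rfl
  rw [this, lpModular, eLpNorm_comp_measurePreserving hf hT, lpModular]

theorem lpModular_comp_of_map_eq_smul (hα : 0 < α) {f : S → 𝕜} (hf : AEStronglyMeasurable f μ)
    {T : S → S} (hT : Measurable T) {c : ℝ≥0∞} (hTμ : μ.map T = c • μ) :
    lpModular α μ (fun s => f (T s)) = c.toReal * lpModular α μ f := by
  have : (fun s => f (T s)) = f ∘ T := rfl
  have hf' : AEStronglyMeasurable f (μ.map T) := by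
    rw [hTμ]; exact hf.mono_ac (Measure.smul_absolutelyContinuous)
  rw [this, lpModular, ← eLpNorm_map_measure hf' hT.aemeasurable, hTμ,
    eLpNorm_smul_measure_of_ne_top (by simp), ENNReal.toReal_div,
    ENNReal.toReal_one, ENNReal.toReal_ofReal hα.le, smul_eq_mul,
    ENNReal.toReal_mul, Real.mul_rpow ENNReal.toReal_nonneg ENNReal.toReal_nonneg,
    ENNReal.toReal_rpow, ← ENNReal.rpow_mul, one_div, inv_mul_cancel₀ hα.ne', ENNReal.rpow_one,
    lpModular]

theorem map_eq_const_smul_of_rnDeriv [SigmaFinite μ] {T : S → S} (hT : Measurable T)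
    (hnull : ∀ A, MeasurableSet A → μ A = 0 → μ (T ⁻¹' A) = 0) {c : ℝ≥0∞}
    (hc : (μ.map T).rnDeriv μ =ᵐ[μ] fun _ => c) : μ.map T = c • μ := by
  have hac : μ.map T ≪ μ := Measure.AbsolutelyContinuous.mk fun A hA h0 => by
    rw [Measure.map_apply hT hA]
    exact hnull A hA h0
  rw [← Measure.withDensity_rnDeriv_eq (μ.map T) μ hac, withDensity_congr_ae hc, withDensity_const]

theorem lpModular_congr_ae {f g : S → 𝕜} (h : f =ᵐ[μ] g) : lpModular α μ f = lpModular α μ g := by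
  rw [lpModular, eLpNorm_congr_ae h, lpModular]

theorem hasSaSLaw_finsetSum [IsProbabilityMeasure P] (hα : 0 < α)
    (hM : IsSaSRandomMeasure α μ P M) {ι : Type*} (I : Finset ι) (a : ι → 𝕜)
    {f : ι → S → 𝕜} {X : ι → Ω → 𝕜} (hf : ∀ i, MemLp (f i) (ENNReal.ofReal α) μ)
    (hX : ∀ i, IsStableIntegral α μ P M (f i) (X i)) :
    HasSaSLaw α P (fun ω => ∑ i ∈ I, a i * X i ω) (lpModular α μ fun s => ∑ i ∈ I, a i * f i s) :=
  (IsStableIntegral.finsetSum hα hM I a (fun i _ => (hf i).1) fun i _ => hX i).hasSaSLaw hα hM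
    (memLp_finsetSum I fun i _ => (hf i).const_mul (a i))

/-- The finite-dimensional distributions of stable integrals depend on the integrands only through
the `L^α` quasi-norms of their linear combinations. -/
theorem eqInLaw_of_lpModular_eq [IsProbabilityMeasure P] (hα : 0 < α)
    (hM : IsSaSRandomMeasure α μ P M) {T : Type*} {f g : T → S → 𝕜} {X Y : T → Ω → 𝕜}
    (hf : ∀ t, MemLp (f t) (ENNReal.ofReal α) μ) (hg : ∀ t, MemLp (g t) (ENNReal.ofReal α) μ)
    (hX : ∀ t, IsStableIntegral α μ P M (f t) (X t))
    (hY : ∀ t, IsStableIntegral α μ P M (g t) (Y t))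
    (h : ∀ (I : Finset T) (a : I → 𝕜),
      lpModular α μ (fun s => ∑ i, a i * f i s) = lpModular α μ (fun s => ∑ i, a i * g i s)) :
    EqInLaw P X Y := fun I => by
  refine identDistrib_of_scalarCharFun_eq (fun i => (hX i).1) (fun i => (hY i).1) fun a => ?_
  rw [(hasSaSLaw_finsetSum hα hM Finset.univ a (fun i : I => hf i) fun i => hX i).2,
    (hasSaSLaw_finsetSum hα hM Finset.univ a (fun i : I => hg i) fun i => hY i).2, h I a]

theorem IsStableIntegral.sub [IsProbabilityMeasure P] (hα : 0 < α)
    (hM : IsSaSRandomMeasure α μ P M) {f g : S → 𝕜} {Y Z : Ω → 𝕜}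
    (hf : AEStronglyMeasurable f μ) (hg : AEStronglyMeasurable g μ)
    (hY : IsStableIntegral α μ P M f Y) (hZ : IsStableIntegral α μ P M g Z) :
    IsStableIntegral α μ P M (fun s => f s - g s) (fun ω => Y ω - Z ω) := by
  simpa [← sub_eq_add_neg] using linComb hα hM 1 (-1) hf hg hY hZ

theorem IsStableIntegral.const_mul [IsProbabilityMeasure P] (hα : 0 < α)
    (hM : IsSaSRandomMeasure α μ P M) (c : 𝕜) {f : S → 𝕜} {Y : Ω → 𝕜}
    (hf : AEStronglyMeasurable f μ) (hY : IsStableIntegral α μ P M f Y) :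
    IsStableIntegral α μ P M (fun s => c * f s) (fun ω => c * Y ω) := by
  simpa using linComb hα hM c 0 hf hf hY hY

/-! ### The cocycle `f` under the two flows -/

variable {φ ψ : ℝ → S → S} {g₀ : S → 𝕜} {f : ℝ → S → 𝕜}

theorem cocycle_sub (hφ : IsFlow φ) (hf : ∀ t s, f t s = g₀ (φ t s) - g₀ s) (t h : ℝ) (s : S) :
    f t (φ h s) = f (t + h) s - f h s := by
  simp only [hf, hφ.add]
  ring

theorem cocycle_increment (hφ : IsFlow φ) (hf : ∀ t s, f t s = g₀ (φ t s) - g₀ s) (t u h : ℝ)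
    (s : S) : f t (φ h s) - f u (φ h s) = f (t + h) s - f (u + h) s := by
  simp only [cocycle_sub hφ hf]
  ring

/-- The scaling relation for `f`, assumed at positive times, scales the quasi-norms of linear
combinations over arbitrary times. -/
theorem lpModular_sum_scaling [SigmaFinite μ] (hα : 0 < α) (hφ : IsFlow φ)
    (hφμ : ∀ t, MeasurePreserving (φ t) μ μ) (hf : ∀ t s, f t s = g₀ (φ t s) - g₀ s)
    (hfm : ∀ t, AEStronglyMeasurable (f t) μ) {r₁ r₂ l : ℝ} (hl : 0 < l)
    (hψ : Measurable (ψ l)) (hψμ : μ.map (ψ l) = ENNReal.ofReal (l ^ (r₁ * α)) • μ)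
    (hfψ : ∀ t, 0 < t → f (l * t) =ᵐ[μ] fun s => (l ^ r₂ : ℝ) • f t (ψ l s))
    {ι : Type*} (I : Finset ι) (τ : ι → ℝ) (a : ι → 𝕜) :
    lpModular α μ (fun s => ∑ i ∈ I, a i * f (l * τ i) s) =
      (l ^ (r₁ + r₂)) ^ α * lpModular α μ (fun s => ∑ i ∈ I, a i * f (τ i) s) := by
  -- A shift of the flow by `h` makes all times `τ i` positive.
  obtain ⟨h, hh0, hh⟩ : ∃ h : ℝ, 0 < h ∧ ∀ i ∈ I, 0 < τ i + h := by
    refine ⟨1 + ∑ i ∈ I, |τ i|, by positivity, fun i hi => ?_⟩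
    have := Finset.single_le_sum (f := fun i => |τ i|) (fun j _ => abs_nonneg _) hi
    have := neg_abs_le (τ i)
    linarith
  have hm : ∀ τ : ι → ℝ, AEStronglyMeasurable (fun s => ∑ i ∈ I, a i * f (τ i) s) μ := fun τ =>
    Finset.aestronglyMeasurable_fun_sum I fun i _ => (hfm (τ i)).const_mul (a i)
  have hmφ : AEStronglyMeasurable (fun s => ∑ i ∈ I, a i * f (τ i) (φ h s)) μ :=
    (hm τ).comp_measurePreserving (hφμ h)
  have hae : (fun s => ∑ i ∈ I, a i * f (l * τ i) (φ (l * h) s)) =ᵐ[μ]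
      fun s => ((l ^ r₂ : ℝ) : 𝕜) * ∑ i ∈ I, a i * f (τ i) (φ h (ψ l s)) := by
    have h1 : ∀ i ∈ I, ∀ᵐ s ∂μ, f (l * (τ i + h)) s = (l ^ r₂ : ℝ) • f (τ i + h) (ψ l s) :=
      fun i hi => hfψ _ (hh i hi)
    filter_upwards [(ae_ball_iff I.countable_toSet).2 h1, hfψ h hh0] with s hs1 hs2
    rw [Finset.mul_sum]
    refine Finset.sum_congr rfl fun i hi => ?_
    rw [cocycle_sub hφ hf, cocycle_sub hφ hf, ← mul_add, hs1 i hi, hs2, RCLike.real_smul_eq_coe_mul,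
      RCLike.real_smul_eq_coe_mul]
    ring
  rw [← lpModular_comp_measurePreserving (hm fun i => l * τ i) (hφμ (l * h)),
    lpModular_congr_ae hae, lpModular_const_mul,
    lpModular_comp_of_map_eq_smul hα hmφ hψ hψμ,
    lpModular_comp_measurePreserving (hm τ) (hφμ h), RCLike.norm_ofReal,
    abs_of_pos (by positivity), ENNReal.toReal_ofReal (by positivity), ← mul_assoc,
    Real.rpow_add hl, Real.mul_rpow (by positivity) (by positivity), ← Real.rpow_mul hl.le r₁,
    mul_comm ((l ^ r₂) ^ α)]

theorem lpModular_cocycle_neg (hφ : IsFlow φ)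
    (hφμ : ∀ t, MeasurePreserving (φ t) μ μ) (hf : ∀ t s, f t s = g₀ (φ t s) - g₀ s)
    (hfm : ∀ t, AEStronglyMeasurable (f t) μ) (t : ℝ) :
    lpModular α μ (f (-t)) = lpModular α μ (f t) := by
  rw [← lpModular_comp_measurePreserving (hfm (-t)) (hφμ t)]
  have : (fun s => f (-t) (φ t s)) = fun s => (-1 : 𝕜) * f t s := by
    funext s
    rw [cocycle_sub hφ hf, neg_add_cancel, hf 0, hφ.zero]
    ring
  rw [this, lpModular_const_mul]
  simp

theorem lpModular_cocycle_sub (hφ : IsFlow φ)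
    (hφμ : ∀ t, MeasurePreserving (φ t) μ μ) (hf : ∀ t s, f t s = g₀ (φ t s) - g₀ s)
    (hfm : ∀ t, AEStronglyMeasurable (f t) μ) (t u : ℝ) :
    lpModular α μ (f t - f u) = lpModular α μ (f |t - u|) := by
  have h1 : lpModular α μ (f t - f u) = lpModular α μ (f (t - u)) := by
    rw [← lpModular_comp_measurePreserving (hfm (t - u)) (hφμ u)]
    congr 1
    funext s
    rw [cocycle_sub hφ hf, sub_add_cancel, Pi.sub_apply]
  rw [h1]
  rcases abs_choice (t - u) with h | h <;> rw [h]
  exact (lpModular_cocycle_neg hφ hφμ hf hfm _).symm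

/-- By separability of `L^α(μ)`, an uncountable family has two members that are arbitrarily close. -/
theorem exists_lpModular_sub_lt [MeasurableSpace.CountablyGenerated S] [SigmaFinite μ]
    (hα : 0 < α) {T : Set ℝ} (hT : ¬ T.Countable) {f : ℝ → S → 𝕜}
    (hf : ∀ t, MemLp (f t) (ENNReal.ofReal α) μ) {v : ℝ} (hv : 0 < v) :
    ∃ t ∈ T, ∃ u ∈ T, t ≠ u ∧ lpModular α μ (f t - f u) < v := by
  by_contra! hcon
  obtain ⟨D, hDc, hDm, hD⟩ :=
    exists_countable_dense_eLpNorm (E := 𝕜) (μ := μ) (ENNReal.ofReal α) (by simp)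
  obtain ⟨η, hη, hη'⟩ := exists_Lp_half 𝕜 μ (ENNReal.ofReal α)
    (ENNReal.ofReal_pos.2 (Real.rpow_pos_of_pos hv α⁻¹)).ne'
  choose g hgD hg using fun t => hD (f t) (hf t) η hη.ne'
  -- Two members with the same approximant in `D` are close, so the choice of `g` is injective on `T`.
  refine hT (Set.MapsTo.countable_of_injOn (f := g) (fun t _ => hgD t)
    (fun t ht u hu htu => ?_) hDc)
  by_contra hne
  refine absurd (hcon t ht u hu hne) (not_le.2 ?_)
  have hu' : eLpNorm (g u - f u) (ENNReal.ofReal α) μ ≤ η := by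
    rw [eLpNorm_sub_comm]; exact hg u
  have hlt := hη' _ _ ((hf t).1.sub (hDm _ (hgD t))) ((hDm _ (hgD u)).sub (hf u).1) (hg t) hu'
  rw [htu, sub_add_sub_cancel] at hlt
  have hlt' : (eLpNorm (f t - f u) (ENNReal.ofReal α) μ).toReal < v ^ α⁻¹ :=
    (ENNReal.lt_ofReal_iff_toReal_lt (ne_top_of_lt hlt)).1 hlt
  calc lpModular α μ (f t - f u) < (v ^ α⁻¹) ^ α :=
        Real.rpow_lt_rpow ENNReal.toReal_nonneg hlt' hα
    _ = v := by rw [← Real.rpow_mul hv.le, inv_mul_cancel₀ hα.ne', Real.rpow_one]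

/-- If `H ≤ 0` and `f` does not vanish, then the `f u` with `u` in an interval `(0, T)` are uniformly
separated, against separability. -/
theorem exponent_pos_of_lpModular_scaling [MeasurableSpace.CountablyGenerated S] [SigmaFinite μ]
    (hα : 0 < α) (hφ : IsFlow φ)
    (hφμ : ∀ t, MeasurePreserving (φ t) μ μ) (hf : ∀ t s, f t s = g₀ (φ t s) - g₀ s)
    (hfL : ∀ t, MemLp (f t) (ENNReal.ofReal α) μ) {H : ℝ}
    (hscale : ∀ l t, 0 < l → lpModular α μ (f (l * t)) = (l ^ H) ^ α * lpModular α μ (f t))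
    {t : ℝ} (ht : lpModular α μ (f t) ≠ 0) : 0 < H := by
  by_contra! hH
  have hfm := fun t => (hfL t).1
  obtain ⟨T, hT0, hT⟩ : ∃ T : ℝ, 0 < T ∧ lpModular α μ (f T) ≠ 0 := by
    refine ⟨|t|, abs_pos.2 ?_, ?_⟩
    · rintro rfl
      refine ht ?_
      have : f 0 = fun s => (0 : 𝕜) * 0 := by
        funext s; rw [hf, hφ.zero]; simp
      rw [this, lpModular_const_mul]
      simp [Real.zero_rpow hα.ne']
    · rcases abs_choice t with h | h <;> rw [h]
      · exact ht
      · rwa [lpModular_cocycle_neg hφ hφμ hf hfm]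
  have hTpos : 0 < lpModular α μ (f T) := (lpModular_nonneg _).lt_of_ne' hT
  have huncount : ¬ (Set.Ioo 0 T).Countable := fun hc => by
    have := hc.measure_zero volume
    rw [Real.volume_Ioo, ENNReal.ofReal_eq_zero] at this
    linarith
  obtain ⟨u, hu, w, hw, huw, hlt⟩ := exists_lpModular_sub_lt hα huncount hfL hTpos
  rw [lpModular_cocycle_sub hφ hφμ hf hfm] at hlt
  have hpos : 0 < |u - w| / T := div_pos (abs_pos.2 (sub_ne_zero.2 huw)) hT0
  have hle : |u - w| / T ≤ 1 := by
    rw [div_le_one hT0, abs_le]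
    constructor <;> linarith [hu.1, hu.2, hw.1, hw.2]
  have hs := hscale (|u - w| / T) T hpos
  rw [div_mul_cancel₀ _ hT0.ne'] at hs
  have h1 : 1 ≤ ((|u - w| / T) ^ H) ^ α :=
    Real.one_le_rpow (Real.one_le_rpow_of_pos_of_le_one_of_nonpos hpos hle hH) hα.le
  rw [hs] at hlt
  nlinarith

end StableFamily

/-! ### Stationary increments, self-similarity and positivity of the exponent -/

theorem theorem3p6 {𝕜 S Ω : Type*} [RCLike 𝕜]
    [MeasurableSpace S] [StandardBorelSpace S] (μ : Measure S) [SigmaFinite μ]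
    [MeasurableSpace Ω] (P : Measure Ω) [IsProbabilityMeasure P]
    (α : ℝ) (hα0 : 0 < α) (hα2 : α < 2)
    (M : Set S → Ω → 𝕜) (hM : IsSaSRandomMeasure α μ P M)
    (φ : ℝ → S → S) (hφ : IsFlow φ) (hφμ : ∀ t, MeasurePreserving (φ t) μ μ)
    (g₀ : S → 𝕜) (hg₀ : AEMeasurable g₀ μ)
    (f : ℝ → S → 𝕜) (hf : ∀ t s, f t s = g₀ (φ t s) - g₀ s)
    (hfL : ∀ t, MemLp (f t) (ENNReal.ofReal α) μ)
    (ψ : ℝ → S → S) (hψ : IsNonsingularMulFlow μ ψ) (r₁ r₂ : ℝ)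
    (hψμ : ∀ l : ℝ, 0 < l →
      (μ.map (ψ l)).rnDeriv μ =ᵐ[μ] fun _ => ENNReal.ofReal (l ^ (r₁ * α)))
    (hfψ : ∀ t l : ℝ, 0 < t → 0 < l →
      f (l * t) =ᵐ[μ] fun s => (l ^ r₂ : ℝ) • f t (ψ l s)) :
    (∀ t, ∃ Y : Ω → 𝕜, IsStableIntegral α μ P M (f t) Y) ∧
    ∀ X : ℝ → Ω → 𝕜, (∀ t, IsStableIntegral α μ P M (f t) (X t)) →
      IsSaSProcess α P X ∧ HasStationaryIncrements P X ∧ IsSelfSimilar P (r₁ + r₂) X ∧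
      ((∃ t, ¬ X t =ᵐ[P] 0) → 0 < r₁ + r₂) := by
  have hmap : ∀ l, 0 < l → μ.map (ψ l) = ENNReal.ofReal (l ^ (r₁ * α)) • μ := fun l hl =>
    map_eq_const_smul_of_rnDeriv (hψ.1.measurable l hl)
      (fun A hA => (hψ.2 l hl A hA).2) (hψμ l hl)
  have hfm := fun t => (hfL t).1
  have hscale : ∀ {l : ℝ}, 0 < l → ∀ {ι : Type} (I : Finset ι) (τ : ι → ℝ) (a : ι → 𝕜),
      lpModular α μ (fun s => ∑ i ∈ I, a i * f (l * τ i) s) =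
        (l ^ (r₁ + r₂)) ^ α * lpModular α μ (fun s => ∑ i ∈ I, a i * f (τ i) s) :=
    fun hl _ I τ a => lpModular_sum_scaling hα0 hφ hφμ hf hfm hl
      (hψ.1.measurable _ hl) (hmap _ hl) (fun t ht => hfψ t _ ht hl) I τ a
  refine ⟨fun t => exists_isStableIntegral hα0 hM (hfL t), fun X hX => ⟨?_, ?_, ?_, ?_⟩⟩
  · exact fun I a => (hasSaSLaw_finsetSum hα0 hM I a hfL hX).isSaS hα0 (lpModular_nonneg _)
  · intro h
    refine eqInLaw_of_lpModular_eq hα0 hM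
      (f := fun p s => f (p.1 + h) s - f (p.2 + h) s) (g := fun p s => f p.1 s - f p.2 s)
      (fun p => (hfL (p.1 + h)).sub (hfL (p.2 + h))) (fun p => (hfL p.1).sub (hfL p.2))
      (fun p => (hX (p.1 + h)).sub hα0 hM (hfm (p.1 + h)) (hfm (p.2 + h)) (hX (p.2 + h)))
      (fun p => (hX p.1).sub hα0 hM (hfm p.1) (hfm p.2) (hX p.2)) fun I a => ?_
    have hm : AEStronglyMeasurable
        (fun s => ∑ p : I, a p * (f (p : ℝ × ℝ).1 s - f (p : ℝ × ℝ).2 s)) μ :=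
      Finset.aestronglyMeasurable_fun_sum _ fun p _ =>
        ((hfm p.1.1).sub (hfm p.1.2)).const_mul (a p)
    rw [← lpModular_comp_measurePreserving hm (hφμ h)]
    simp only [cocycle_increment hφ hf]
  · intro l hl
    have hX' : ∀ t, IsStableIntegral α μ P M (fun s => ((l ^ (r₁ + r₂) : ℝ) : 𝕜) * f t s)
        (fun ω => (l ^ (r₁ + r₂) : ℝ) • X t ω) := fun t => by
      simpa only [RCLike.real_smul_eq_coe_mul] using (hX t).const_mul hα0 hM _ (hfm t)
    refine eqInLaw_of_lpModular_eq hα0 hM (fun t => hfL (l * t)) (fun t => (hfL t).const_mul _)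
      (fun t => hX (l * t)) hX' fun I a => ?_
    rw [hscale hl Finset.univ (fun i : I => (i : ℝ)) a]
    simp only [mul_left_comm (a _), ← Finset.mul_sum]
    rw [lpModular_const_mul, RCLike.norm_ofReal, abs_of_pos (by positivity)]
  · rintro ⟨t, ht⟩
    refine exponent_pos_of_lpModular_scaling hα0 hφ hφμ hf hfL (fun l t hl => ?_) (t := t) ?_
    · simpa using hscale hl {()} (fun _ => t) fun _ => 1
    · intro h0
      have := (hX t).hasSaSLaw hα0 hM (hfL t)
      rw [h0] at this
      exact ht (this.ae_eq_zero hα0)
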